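/- Let $a,b,c\in\mathbb{R}$ be such that the four numbers $$f_1=1-a-b-c,\quad f_2=1-a+b+c,\quad f_3=1+a-b+c,\quad f_4=1+a+b-c$$ are all positive, and let $\sigma>0$. On a probability space, let $\epsilon=\{\epsilon_{i,j}:i,j\in\mathbb{Z}\}$ be pairwise uncorrelated real random variables with zero mean and equal variance $\sigma^2$, and let $X=\{X_{i,j}:i,j\in\mathbb{Z}\}$ be a real wide-sense stationary random field (finite second moments, constant mean, shift-invariant covariances) such that, for all $i,j\in\mathbb{Z}$, almost surely $$X_{i,j}=aX_{i-1,j}+bX_{i,j-1}+cX_{i-1,j-1}+\epsilon_{i,j}.$$ Let $\gamma(h_1,h_2)=\operatorname{cov}(X_{i,j},X_{i-h_1,j-h_2})$ be the autocovariance function of $X$ (which does not depend on $i,j$). Then: 1. $\operatorname{cov}(X_{i,j},\epsilon_{k,l})=0$ for all integers $i,j,k,l$ with $k>i$ or $l>j$. 2. $\gamma(0,0)=a\gamma(1,0)+b\gamma(0,1)+c\gamma(1,1)+\sigma^2$. 3. $\gamma(h_1,h_2)=a\gamma(h_1-1,h_2)+b\gamma(h_1,h_2-1)+c\gamma(h_1-1,h_2-1)$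 for all integers $h_1,h_2$ with $\max(h_1,h_2)>0$. -/

import Mathlib

open MeasureTheory ProbabilityTheory

namespace PlanarAR

/-- A real random field `X = (X i j)` on the lattice `ℤ × ℤ` is wide-sense stationary: finite second
moments, constant mean, and covariances invariant under shifts of the lattice. -/
structure IsWideSenseStationary {Ω : Type*} [MeasurableSpace Ω] (μ : Measure Ω)
    (X : ℤ → ℤ → Ω → ℝ) : Prop where
  memLp_two : ∀ i j : ℤ, MemLp (X i j) 2 μ
  mean_eq : ∃ m : ℝ, ∀ i j : ℤ, μ[X i j] = m
  cov_shift : ∀ s t i j k l : ℤ,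
    cov[X (i + s) (j + t), X (k + s) (l + t); μ] = cov[X i j, X k l; μ]

/-- White noise with variance `v`: square-integrable, zero-mean, pairwise uncorrelated random
variables, all of variance `v`. -/
structure IsWhiteNoise {Ω : Type*} [MeasurableSpace Ω] (μ : Measure Ω)
    (ε : ℤ → ℤ → Ω → ℝ) (v : ℝ) : Prop where
  memLp_two : ∀ i j : ℤ, MemLp (ε i j) 2 μ
  mean_zero : ∀ i j : ℤ, μ[ε i j] = 0
  variance_eq : ∀ i j : ℤ, Var[ε i j; μ] = v
  uncorrelated : ∀ i j k l : ℤ, (i, j) ≠ (k, l) → cov[ε i j, ε k l; μ] = 0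

/-- The equation `X i j = a X (i-1) j + b X i (j-1) + c X (i-1) (j-1) + ε i j`, at every lattice
point, almost surely. -/
def SatisfiesAR {Ω : Type*} [MeasurableSpace Ω] (μ : Measure Ω) (a b c : ℝ)
    (X ε : ℤ → ℤ → Ω → ℝ) : Prop :=
  ∀ i j : ℤ, ∀ᵐ ω ∂μ,
    X i j ω = a * X (i - 1) j ω + b * X i (j - 1) ω + c * X (i - 1) (j - 1) ω + ε i j ω

/-- The autocovariance function `γ h₁ h₂ = cov (X i j, X (i - h₁) (j - h₂))` of a wide-sense
stationary field, evaluated at `i = j = 0`. -/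
noncomputable def autocov {Ω : Type*} [MeasurableSpace Ω] (μ : Measure Ω)
    (X : ℤ → ℤ → Ω → ℝ) (h₁ h₂ : ℤ) : ℝ :=
  cov[X 0 0, X (-h₁) (-h₂); μ]

/-- For a stationary field, the base point in the autocovariance function is irrelevant. -/
theorem IsWideSenseStationary.cov_eq_autocov {Ω : Type*} [MeasurableSpace Ω] {μ : Measure Ω}
    {X : ℤ → ℤ → Ω → ℝ} (hX : IsWideSenseStationary μ X) (i j h₁ h₂ : ℤ) :
    cov[X i j, X (i - h₁) (j - h₂); μ] = autocov μ X h₁ h₂ := by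
  have h := hX.cov_shift i j 0 0 (-h₁) (-h₂)
  rw [zero_add, zero_add, neg_add_eq_sub, neg_add_eq_sub] at h
  exact h

end PlanarAR

namespace PlanarAR

section SquareSummable

/-! Everything rests on causality (claim 1). Fix one noise variable and let g(m,n) = cov(X_{m,n},
ε_{0,0}). Joint stationarity and Bessel's inequality make g square-summable, and g satisfies the
homogeneous recursion off the origin. With g_n the n-th row and S the shift, this reads (1 - aS) g_n
= (b + cS) g_{n-1} for n < 0. On |z| = 1, positivity of the f_i gives |1 - az|² - |b + cz|² ≥ δ > 0,
so ‖(1 - aS) g_n‖² cannot decrease as n → -∞; it also tends to 0, hence g_n = 0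
(`eq_zero_of_recursion`). Columns are symmetric. The Yule–Walker equations follow by taking
covariances of the recursion with X (`SatisfiesAR.autocov_eq`). -/

theorem summable_sub_one {f : ℤ → ℝ} (hf : Summable f) : Summable fun m => f (m - 1) :=
  (Equiv.subRight (1 : ℤ)).summable_iff.2 hf

theorem tsum_sub_one (f : ℤ → ℝ) : ∑' m, f (m - 1) = ∑' m, f m :=
  (Equiv.subRight (1 : ℤ)).tsum_eq f

theorem sq_add_le_two_mul (x y s t : ℝ) :
    (x * s + y * t) ^ 2 ≤ 2 * x ^ 2 * s ^ 2 + 2 * y ^ 2 * t ^ 2 := by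
  nlinarith [sq_nonneg (x * s - y * t)]

theorem summable_sq_shift_comb {u : ℤ → ℝ} (hu : Summable fun m => u m ^ 2) (x y : ℝ) :
    Summable fun m => (x * u m + y * u (m - 1)) ^ 2 :=
  Summable.of_nonneg_of_le (fun _ => sq_nonneg _) (fun _ => sq_add_le_two_mul _ _ _ _)
    ((hu.mul_left _).add ((summable_sub_one hu).mul_left _))

theorem tsum_sq_shift_comb_le {u : ℤ → ℝ} (hu : Summable fun m => u m ^ 2) (x y : ℝ) :
    ∑' m, (x * u m + y * u (m - 1)) ^ 2 ≤ (2 * x ^ 2 + 2 * y ^ 2) * ∑' m, u m ^ 2 := by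
  have hu' := summable_sub_one hu
  calc ∑' m, (x * u m + y * u (m - 1)) ^ 2
      ≤ ∑' m, (2 * x ^ 2 * u m ^ 2 + 2 * y ^ 2 * u (m - 1) ^ 2) :=
        (summable_sq_shift_comb hu x y).tsum_le_tsum (fun _ => sq_add_le_two_mul _ _ _ _)
          ((hu.mul_left _).add (hu'.mul_left _))
    _ = _ := by
        rw [(hu.mul_left _).tsum_add (hu'.mul_left _), tsum_mul_left, tsum_mul_left,
          tsum_sub_one fun m => u m ^ 2]
        ring

/-- The gap between the quadratic forms `‖u - a S u‖²` and `‖b u + c S u‖²`, `S` the shift. -/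
theorem energy_gap {u : ℤ → ℝ} (hu : Summable fun m => u m ^ 2) (a b c : ℝ) :
    (1 + a ^ 2 - b ^ 2 - c ^ 2 - 2 * |a + b * c|) * ∑' m, u m ^ 2
        + ∑' m, (b * u m + c * u (m - 1)) ^ 2
      ≤ ∑' m, (1 * u m + -a * u (m - 1)) ^ 2 := by
  have hu' := summable_sub_one hu
  -- The squares differ by a cross term -2(a + bc) u_m u_{m-1}, which AM-GM splits between u_m² and
  -- u_{m-1}²; after summation the shift merges the two coefficients.
  have key : ∀ m, ((1 - b ^ 2 - |a + b * c|) * u m ^ 2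
      + (a ^ 2 - c ^ 2 - |a + b * c|) * u (m - 1) ^ 2) + (b * u m + c * u (m - 1)) ^ 2
      ≤ (1 * u m + -a * u (m - 1)) ^ 2 := by
    intro m
    have h : 2 * ((a + b * c) * (u m * u (m - 1)))
        ≤ |a + b * c| * (u m ^ 2 + u (m - 1) ^ 2) := by
      have h₁ : (a + b * c) * (u m * u (m - 1)) ≤ |a + b * c| * |u m * u (m - 1)| :=
        (le_abs_self _).trans (abs_mul _ _).le
      have h₂ : 2 * |u m * u (m - 1)| ≤ u m ^ 2 + u (m - 1) ^ 2 := by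
        rw [abs_mul, ← sq_abs (u m), ← sq_abs (u (m - 1)), ← mul_assoc]
        exact two_mul_le_add_sq _ _
      nlinarith [mul_le_mul_of_nonneg_left h₂ (abs_nonneg (a + b * c))]
    linarith
  have h₁ := hu.mul_left (1 - b ^ 2 - |a + b * c|)
  have h₂ := hu'.mul_left (a ^ 2 - c ^ 2 - |a + b * c|)
  have h₃ := summable_sq_shift_comb hu b c
  have h := ((h₁.add h₂).add h₃).tsum_le_tsum key (summable_sq_shift_comb hu 1 (-a))
  rw [(h₁.add h₂).tsum_add h₃, h₁.tsum_add h₂, tsum_mul_left, tsum_mul_left,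
    tsum_sub_one fun m => u m ^ 2] at h
  linarith

/-- The two signs of the absolute value give exactly f₁f₂ = (1 - a)² - (b + c)² and f₃f₄ = (1 + a)²
- (b - c)². -/
theorem energy_gap_pos {a b c : ℝ}
    (hf₁ : 0 < 1 - a - b - c) (hf₂ : 0 < 1 - a + b + c)
    (hf₃ : 0 < 1 + a - b + c) (hf₄ : 0 < 1 + a + b - c) :
    0 < 1 + a ^ 2 - b ^ 2 - c ^ 2 - 2 * |a + b * c| := by
  have h₁ := mul_pos hf₁ hf₂
  have h₂ := mul_pos hf₃ hf₄
  rcases abs_cases (a + b * c) with ⟨h, -⟩ | ⟨h, -⟩ <;> rw [h] <;> linarith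

/-- A square-summable array satisfying the homogeneous recursion on a lower half-plane vanishes
there. -/
theorem eq_zero_of_recursion {a b c : ℝ}
    (hf₁ : 0 < 1 - a - b - c) (hf₂ : 0 < 1 - a + b + c)
    (hf₃ : 0 < 1 + a - b + c) (hf₄ : 0 < 1 + a + b - c)
    {g : ℤ → ℤ → ℝ} (hg : Summable fun p : ℤ × ℤ => g p.1 p.2 ^ 2)
    (hrec : ∀ i j : ℤ, j < 0 → g i j = a * g (i - 1) j + b * g i (j - 1) + c * g (i - 1) (j - 1))
    (i j : ℤ) (hj : j < 0) : g i j = 0 := by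
  have hδ := energy_gap_pos hf₁ hf₂ hf₃ hf₄
  set δ := 1 + a ^ 2 - b ^ 2 - c ^ 2 - 2 * |a + b * c|
  have hg' : Summable fun p : ℤ × ℤ => g p.2 p.1 ^ 2 :=
    (Equiv.prodComm ℤ ℤ).summable_iff.2 hg
  have hrow : ∀ n, Summable fun m => g m n ^ 2 := fun n => hg'.prod_factor n
  set N : ℤ → ℝ := fun n => ∑' m, g m n ^ 2 with hN
  set E : ℤ → ℝ := fun n => ∑' m, (1 * g m n + -a * g (m - 1) n) ^ 2 with hE
  have hN0 : ∀ n, 0 ≤ N n := fun n => tsum_nonneg fun _ => sq_nonneg _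
  have hgap : ∀ n, δ * N n + ∑' m, (b * g m n + c * g (m - 1) n) ^ 2 ≤ E n :=
    fun n => energy_gap (hrow n) a b c
  -- The recursion rewrites E n as the (b + cS)-energy of row n - 1, which the gap bounds by E (n -
  -- 1).
  have hstep : ∀ n, n < 0 → E n ≤ E (n - 1) := by
    intro n hn
    have h : E n = ∑' m, (b * g m (n - 1) + c * g (m - 1) (n - 1)) ^ 2 :=
      tsum_congr fun m => by rw [hrec m n hn]; ring
    linarith [hgap (n - 1), mul_nonneg hδ.le (hN0 (n - 1))]
  have hmono : ∀ k : ℕ, E j ≤ E (j - k) := by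
    intro k
    induction k with
    | zero => simp
    | succ k ih =>
      refine ih.trans ((hstep (j - k) (by omega)).trans_eq ?_)
      push_cast
      rw [sub_sub]
  have hNlim : Filter.Tendsto (fun k : ℕ => N (j - k)) Filter.atTop (nhds 0) :=
    (hg'.prod.comp_injective
      (i := fun k : ℕ => j - (k : ℤ)) fun x y h => by simpa using h).tendsto_atTop_zero
  have hElim : E j ≤ 0 := by
    have h := hNlim.const_mul (2 * (1 : ℝ) ^ 2 + 2 * (-a) ^ 2)
    rw [mul_zero] at h
    exact ge_of_tendsto' h fun k => (hmono k).trans (tsum_sq_shift_comb_le (hrow _) 1 (-a))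
  have hNj : N j ≤ 0 := by
    have h : 0 ≤ ∑' m, (b * g m j + c * g (m - 1) j) ^ 2 := tsum_nonneg fun _ => sq_nonneg _
    by_contra! hpos
    linarith [hgap j, mul_pos hδ hpos]
  have hle : g i j ^ 2 ≤ N j := (hrow j).le_tsum i fun _ _ => sq_nonneg _
  exact pow_eq_zero_iff two_ne_zero |>.1 (le_antisymm (hle.trans hNj) (sq_nonneg _))

end SquareSummable

section Covariance

variable {Ω : Type*} [MeasurableSpace Ω] {μ : Measure Ω}

theorem covariance_congr_left {Y Y' Z : Ω → ℝ} (h : Y =ᵐ[μ] Y') :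
    cov[Y, Z; μ] = cov[Y', Z; μ] := by
  rw [covariance, covariance, integral_congr_ae h]
  refine integral_congr_ae ?_
  filter_upwards [h] with ω hω
  rw [hω]

theorem IsWideSenseStationary.autocov_neg {X : ℤ → ℤ → Ω → ℝ}
    (hX : IsWideSenseStationary μ X) (h₁ h₂ : ℤ) :
    autocov μ X (-h₁) (-h₂) = autocov μ X h₁ h₂ := by
  rw [← hX.cov_eq_autocov 0 0 (-h₁) (-h₂), ← hX.cov_eq_autocov h₁ h₂ h₁ h₂, covariance_comm]
  simp

variable [IsProbabilityMeasure μ] {a b c v : ℝ} {X ε : ℤ → ℤ → Ω → ℝ}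

/-- Bessel's inequality for white noise. -/
theorem IsWhiteNoise.summable_sq_covariance (hε : IsWhiteNoise μ ε v) (hv : 0 < v)
    {Y : Ω → ℝ} (hY : MemLp Y 2 μ) :
    Summable fun p : ℤ × ℤ => cov[Y, ε p.1 p.2; μ] ^ 2 := by
  have hinner : ∀ (p : ℤ × ℤ) {Z : Ω → ℝ} (hZ : MemLp Z 2 μ),
      inner ℝ ((hε.memLp_two p.1 p.2).toLp _) (hZ.toLp _) = cov[Z, ε p.1 p.2; μ] := by
    intro p Z hZ
    rw [covariance_eq_sub hZ (hε.memLp_two _ _), hε.mean_zero, mul_zero, sub_zero,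
      L2.inner_def]
    refine integral_congr_ae ?_
    filter_upwards [(hε.memLp_two p.1 p.2).coeFn_toLp, hZ.coeFn_toLp] with ω h₁ h₂
    rw [h₁, h₂]
    simp
  have hs : 0 < √v := Real.sqrt_pos.2 hv
  have horth : Orthonormal ℝ fun p : ℤ × ℤ =>
      (√v)⁻¹ • (hε.memLp_two p.1 p.2).toLp (ε p.1 p.2) := by
    classical
    rw [orthonormal_iff_ite]
    intro p q
    rw [real_inner_smul_left, real_inner_smul_right, hinner]
    split_ifs with hpq
    · subst hpq
      rw [covariance_self (hε.memLp_two _ _).aemeasurable, hε.variance_eq]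
      nth_rewrite 3 [← Real.mul_self_sqrt hv.le]
      field_simp
    · rw [hε.uncorrelated _ _ _ _ (Ne.symm hpq), mul_zero, mul_zero]
  have h := (horth.inner_products_summable (hY.toLp Y)).mul_left v
  refine h.congr fun p => ?_
  rw [real_inner_smul_left, hinner, Real.norm_eq_abs, sq_abs, mul_pow, inv_pow,
    Real.sq_sqrt hv.le]
  field_simp

theorem SatisfiesAR.covariance_left (hAR : SatisfiesAR μ a b c X ε)
    (hX : ∀ i j, MemLp (X i j) 2 μ) (hε : ∀ i j, MemLp (ε i j) 2 μ)
    {Z : Ω → ℝ} (hZ : MemLp Z 2 μ) (i j : ℤ) :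
    cov[X i j, Z; μ] = a * cov[X (i - 1) j, Z; μ] + b * cov[X i (j - 1), Z; μ]
      + c * cov[X (i - 1) (j - 1), Z; μ] + cov[ε i j, Z; μ] := by
  have h : X i j =ᵐ[μ] a • X (i - 1) j + b • X i (j - 1) + c • X (i - 1) (j - 1) + ε i j :=
    hAR i j
  have h₁ := (hX (i - 1) j).const_smul a
  have h₂ := (hX i (j - 1)).const_smul b
  have h₃ := (hX (i - 1) (j - 1)).const_smul c
  rw [covariance_congr_left h, covariance_add_left ((h₁.add h₂).add h₃) (hε i j) hZ,
    covariance_add_left (h₁.add h₂) h₃ hZ, covariance_add_left h₁ h₂ hZ,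
    covariance_smul_left, covariance_smul_left, covariance_smul_left]

/-- A stationary solution and its noise are jointly stationary. -/
theorem SatisfiesAR.cross_cov_shift (hAR : SatisfiesAR μ a b c X ε)
    (hX : IsWideSenseStationary μ X) (hε : ∀ i j, MemLp (ε i j) 2 μ) (s t i j k l : ℤ) :
    cov[X (i + s) (j + t), ε (k + s) (l + t); μ] = cov[X i j, ε k l; μ] := by
  -- With ε in the left slot, the recursion expresses it through X, whose covariances are
  -- shift-invariant.
  rw [covariance_comm, covariance_comm (X i j)]
  have h₁ := hAR.covariance_left hX.memLp_two hε (hX.memLp_two (i + s) (j + t)) (k + s) (l + t)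
  have h₂ := hAR.covariance_left hX.memLp_two hε (hX.memLp_two i j) k l
  rw [add_sub_right_comm k s 1, add_sub_right_comm l t 1, hX.cov_shift, hX.cov_shift,
    hX.cov_shift, hX.cov_shift] at h₁
  linarith

/-- A stationary solution is causal: it is uncorrelated with the noise off the lower-left
quadrant. -/
theorem SatisfiesAR.cross_cov_eq_zero (hAR : SatisfiesAR μ a b c X ε)
    (hf₁ : 0 < 1 - a - b - c) (hf₂ : 0 < 1 - a + b + c)
    (hf₃ : 0 < 1 + a - b + c) (hf₄ : 0 < 1 + a + b - c)
    (hX : IsWideSenseStationary μ X) (hε : IsWhiteNoise μ ε v) (hv : 0 < v)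
    (i j k l : ℤ) (h : i < k ∨ j < l) : cov[X i j, ε k l; μ] = 0 := by
  set g : ℤ → ℤ → ℝ := fun m n => cov[X m n, ε 0 0; μ] with hgdef
  have hg : Summable fun p : ℤ × ℤ => g p.1 p.2 ^ 2 := by
    -- Bessel needs a fixed variable and varying noise: shifting by -p turns cov(X_p, ε_0) into
    -- cov(X_0, ε_{-p}).
    refine ((Equiv.neg (ℤ × ℤ)).summable_iff.2
      (hε.summable_sq_covariance hv (hX.memLp_two 0 0))).congr fun p => ?_
    have := hAR.cross_cov_shift hX hε.memLp_two p.1 p.2 0 0 (-p.1) (-p.2)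
    rw [zero_add, zero_add, neg_add_cancel, neg_add_cancel] at this
    simp only [hgdef, this]
    rfl
  have hrec : ∀ m n : ℤ, m < 0 ∨ n < 0 →
      g m n = a * g (m - 1) n + b * g m (n - 1) + c * g (m - 1) (n - 1) := by
    intro m n hmn
    have := hAR.covariance_left hX.memLp_two hε.memLp_two (hε.memLp_two 0 0) m n
    rwa [hε.uncorrelated m n 0 0 (by rw [Ne, Prod.mk.injEq]; omega), add_zero] at this
  have hshift := hAR.cross_cov_shift hX hε.memLp_two k l (i - k) (j - l) 0 0
  rw [sub_add_cancel, sub_add_cancel, zero_add, zero_add] at hshift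
  rw [hshift]
  rcases h with h | h
  -- Transposing the lattice swaps a with b, hence f₂ with f₃, and fixes f₁ and f₄.
  · refine eq_zero_of_recursion (g := fun n m => g m n) (a := b) (b := a) (c := c)
      (by linarith) (by linarith) (by linarith) (by linarith)
      ((Equiv.prodComm ℤ ℤ).summable_iff.2 hg) (fun n m hm => ?_) (j - l) (i - k) (by omega)
    rw [hrec m n (Or.inl hm)]
    ring
  · exact eq_zero_of_recursion hf₁ hf₂ hf₃ hf₄ hg (fun m n hn => hrec m n (Or.inr hn))
      (i - k) (j - l) (by omega)

/-- Covariance of the recursion at the origin with X_{-h}. Causality kills the last term as soon as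
h₁ > 0 or h₂ > 0. -/
theorem SatisfiesAR.autocov_eq (hAR : SatisfiesAR μ a b c X ε)
    (hX : IsWideSenseStationary μ X) (hε : ∀ i j, MemLp (ε i j) 2 μ) (h₁ h₂ : ℤ) :
    autocov μ X h₁ h₂ = a * autocov μ X (h₁ - 1) h₂ + b * autocov μ X h₁ (h₂ - 1)
      + c * autocov μ X (h₁ - 1) (h₂ - 1) + cov[X (-h₁) (-h₂), ε 0 0; μ] := by
  have h := hAR.covariance_left hX.memLp_two hε (hX.memLp_two (-h₁) (-h₂)) 0 0
  rw [← hX.cov_eq_autocov 0 0 h₁ h₂, ← hX.cov_eq_autocov (0 - 1) 0 (h₁ - 1) h₂,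
    ← hX.cov_eq_autocov 0 (0 - 1) h₁ (h₂ - 1),
    ← hX.cov_eq_autocov (0 - 1) (0 - 1) (h₁ - 1) (h₂ - 1), sub_sub_sub_cancel_right,
    sub_sub_sub_cancel_right, zero_sub, zero_sub, covariance_comm _ (ε 0 0)]
  simpa using h

end Covariance

end PlanarAR

theorem mainTheorem5 {Ω : Type*} [MeasurableSpace Ω] (μ : Measure Ω) [IsProbabilityMeasure μ]
    (a b c σ : ℝ) (hσ : 0 < σ)
    (hf₁ : 0 < 1 - a - b - c) (hf₂ : 0 < 1 - a + b + c)
    (hf₃ : 0 < 1 + a - b + c) (hf₄ : 0 < 1 + a + b - c)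
    (X ε : ℤ → ℤ → Ω → ℝ)
    (hX : PlanarAR.IsWideSenseStationary μ X)
    (hε : PlanarAR.IsWhiteNoise μ ε (σ ^ 2))
    (hAR : PlanarAR.SatisfiesAR μ a b c X ε) :
    (∀ i j k l : ℤ, i < k ∨ j < l → cov[X i j, ε k l; μ] = 0) ∧
    PlanarAR.autocov μ X 0 0 =
      a * PlanarAR.autocov μ X 1 0 + b * PlanarAR.autocov μ X 0 1
        + c * PlanarAR.autocov μ X 1 1 + σ ^ 2 ∧
    (∀ h₁ h₂ : ℤ, 0 < max h₁ h₂ →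
      PlanarAR.autocov μ X h₁ h₂ =
        a * PlanarAR.autocov μ X (h₁ - 1) h₂ + b * PlanarAR.autocov μ X h₁ (h₂ - 1)
          + c * PlanarAR.autocov μ X (h₁ - 1) (h₂ - 1)) := by
  have hv : 0 < σ ^ 2 := pow_pos hσ 2
  have hcausal := hAR.cross_cov_eq_zero hf₁ hf₂ hf₃ hf₄ hX hε hv
  refine ⟨hcausal, ?_, fun h₁ h₂ h => ?_⟩
  -- Only the noise survives in cov(X_{0,0}, ε_{0,0}): the three predecessors are uncorrelated with
  -- ε_{0,0}, leaving σ².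
  · have hcross := hAR.covariance_left hX.memLp_two hε.memLp_two (hε.memLp_two 0 0) 0 0
    rw [hcausal (0 - 1) 0 0 0 (by omega), hcausal 0 (0 - 1) 0 0 (by omega),
      hcausal (0 - 1) (0 - 1) 0 0 (by omega),
      covariance_self (hε.memLp_two 0 0).aemeasurable, hε.variance_eq] at hcross
    have h := hAR.autocov_eq hX hε.memLp_two 0 0
    rw [neg_zero, hcross] at h
    -- The recursion yields γ at (-1,0), (0,-1), (-1,-1); evenness of γ restores the stated signs.
    rw [h, ← hX.autocov_neg 1 0, ← hX.autocov_neg 0 1, ← hX.autocov_neg 1 1]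
    simp
  · have h0 := hAR.autocov_eq hX hε.memLp_two h₁ h₂
    rwa [hcausal (-h₁) (-h₂) 0 0 (by rcases lt_max_iff.1 h with h | h <;> omega), add_zero] at h0
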